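/- Let $X$ be a finite set (the board) and let $\mathcal F\subseteq 2^X$ be a hypergraph (the family of target sets). In the strict $(p,q)$ Avoider–Enforcer game $\mathcal F$, two players, Avoider and Enforcer, move alternately; in each move Avoider claims exactly $p$, and Enforcer exactly $q$, previously unclaimed elements of $X$, except that a player who finds fewer unclaimed elements than that before his move claims all of them. The game ends when all elements of $X$ have been claimed; Avoider loses if he has then claimed all the elements of some target set, and otherwise he wins (so Enforcer wins exactly when Avoider loses). A matching in $\mathcal F$ is a set $\mathcal M\subseteq\mathcal F$ of pairwise disjoint edges. Let $p,q,k$ be positive integers such that $\gcd(p+q,\ell)\le p$ for every $1\le \ell\le k$. Then there exists an integer $N=N(p,q,k)$ such that for every finite set $X$ and every hypergraph $\mathcal F\subseteq 2^X$: if $\mathcal F$ contains a matching $\mathcal M\subseteq\mathcal F$ with $|\mathcal M|=N$ and $|T|\le k$ for every $T\in\mathcal M$, then Enforcer has a winning strategy in the strict $(p,q)$ Avoider–Enforcer game $\mathcal F$, both when he is the first player to move and when he is the second. -/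

import Mathlib

namespace AvoiderEnforcer

/-- The two players. -/
inductive Player where
  | avoider : Player
  | enforcer : Player

/-- A position between two moves on the board `X`: the elements claimed so far by each player,
and the player whose move it is. -/
structure Position (X : Type*) where
  avoiderSet : Finset X
  enforcerSet : Finset X
  turn : Player

/-- The number of elements that a player claims per move in the strict `(p, q)` game. -/
def bias (p q : ℕ) : Player → ℕ
  | Player.avoider => p
  | Player.enforcer => q

/-- The position at the beginning of the game: nothing is claimed, and `first` is to move. -/
def start (X : Type*) (first : Player) : Position X where
  avoiderSet := ∅
  enforcerSet := ∅
  turn := first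

/-- The elements of the board that nobody has claimed yet. -/
def Position.unclaimed {X : Type*} [Fintype X] [DecidableEq X] (P : Position X) : Finset X :=
  (P.avoiderSet ∪ P.enforcerSet)ᶜ

/-- The strict rules: the player to move claims exactly `p` (Avoider) or exactly `q` (Enforcer)
unclaimed elements, or all the unclaimed elements if fewer than that are left. -/
def IsLegalMove {X : Type*} [Fintype X] [DecidableEq X] (p q : ℕ) (P : Position X)
    (S : Finset X) : Prop :=
  S ⊆ P.unclaimed ∧ S.card = min (bias p q P.turn) P.unclaimed.card

/-- The position after the player to move in `P` has claimed the set `S`. -/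
def Position.move {X : Type*} [DecidableEq X] (P : Position X) (S : Finset X) : Position X :=
  match P.turn with
  | Player.avoider => ⟨P.avoiderSet ∪ S, P.enforcerSet, Player.enforcer⟩
  | Player.enforcer => ⟨P.avoiderSet, P.enforcerSet ∪ S, Player.avoider⟩

/-- A strategy of Enforcer tells him which set to claim in each position where he is to move;
`σ` is such a strategy if all these moves are legal. -/
def IsEnforcerStrategy {X : Type*} [Fintype X] [DecidableEq X] (p q : ℕ)
    (σ : Position X → Finset X) : Prop :=
  ∀ P : Position X, P.turn = Player.enforcer → IsLegalMove p q P (σ P)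

/-- `P 0, P 1, P 2, …` is a play of the strict `(p, q)` game begun by `first` in which Avoider
makes arbitrary legal moves and Enforcer follows `σ`. (Once the board is exhausted the only
legal move is to claim `∅`, so that the two sets of claimed elements do not change any more.) -/
def IsPlay {X : Type*} [Fintype X] [DecidableEq X] (p q : ℕ) (first : Player)
    (σ : Position X → Finset X) (P : ℕ → Position X) : Prop :=
  P 0 = start X first ∧
    ∀ i : ℕ, ∃ S : Finset X, IsLegalMove p q (P i) S ∧ P (i + 1) = (P i).move S ∧
      ((P i).turn = Player.enforcer → S = σ (P i))

/-- Avoider has lost at `P`: all elements of the board are claimed, and Avoider has claimed all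
the elements of some target set. -/
def AvoiderHasLost {X : Type*} [Fintype X] [DecidableEq X] (F : Set (Finset X))
    (P : Position X) : Prop :=
  P.unclaimed = ∅ ∧ ∃ T ∈ F, T ⊆ P.avoiderSet

/-- Enforcer has a winning strategy in the strict `(p, q)` Avoider-Enforcer game with board `X`
and family of target sets `F`, when `first` makes the first move. -/
def EnforcerHasWinningStrategy {X : Type*} [Fintype X] [DecidableEq X] (p q : ℕ)
    (F : Set (Finset X)) (first : Player) : Prop :=
  ∃ σ : Position X → Finset X, IsEnforcerStrategy p q σ ∧
    ∀ P : ℕ → Position X, IsPlay p q first σ P → ∃ m : ℕ, AvoiderHasLost F (P m)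

end AvoiderEnforcer

namespace AvoiderEnforcer

/-! ### Live matchings and their progress count. -/

section

variable {X : Type*} [DecidableEq X] {F : Set (Finset X)}

/-! Induct on the number `K` of unclaimed elements allowed per edge of a matching untouched by
Enforcer. Call an unclaimed element free if it lies in no edge of the matching, and let `D` be `K`
times the number of edges minus the number of their unclaimed elements. Once `D ≥ K * N`, at least
`N` edges have dropped below `K` and the induction hypothesis applies.

To make `D` grow, Enforcer claims free elements only. If these run short, he gives up a few full
edges, each adding exactly `K` free elements and leaving `D` unchanged. So a round in which Avoider
too stays on free elements changes their number by `-(p + q)` modulo `K`. As `gcd (p + q, K) ≤ p`,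
fewer than `K` such rounds bring the residue below `p`. Giving up as few edges as possible keeps the
number itself below `K`, so fewer than `p` free elements remain and Avoider must enter the matching.
Each round costs at most `q` edges, so a large enough matching lasts (`wins_of_edgeBound`). -/

theorem Position.avoiderSet_subset_move (P : Position X) (S : Finset X) :
    P.avoiderSet ⊆ (P.move S).avoiderSet := by
  unfold Position.move
  split <;> simp

theorem Position.avoiderSet_move_empty (P : Position X) :
    (P.move ∅).avoiderSet = P.avoiderSet := by
  unfold Position.move
  split <;> simp

/-- `M` is a matching of target sets untouched by Enforcer, in each of which at most `K` elements
are unclaimed. -/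
structure IsLiveMatching (F : Set (Finset X)) (K : ℕ) (P : Position X)
    (M : Finset (Finset X)) : Prop where
  subset : (M : Set (Finset X)) ⊆ F
  disj : (M : Set (Finset X)).PairwiseDisjoint id
  untouched : ∀ T ∈ M, Disjoint T P.enforcerSet
  card_le : ∀ T ∈ M, (T \ P.avoiderSet).card ≤ K

/-- The unclaimed elements of a live matching. -/
def residual (P : Position X) (M : Finset (Finset X)) : Finset X :=
  M.biUnion fun T => T \ P.avoiderSet

variable {K : ℕ} {P : Position X} {M : Finset (Finset X)}

theorem IsLiveMatching.mono (h : IsLiveMatching F K P M) {M' : Finset (Finset X)} (hM : M' ⊆ M) :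
    IsLiveMatching F K P M' :=
  ⟨fun _ hT => h.subset (hM hT), h.disj.subset (by exact_mod_cast hM),
    fun T hT => h.untouched T (hM hT), fun T hT => h.card_le T (hM hT)⟩

theorem IsLiveMatching.card_residual (h : IsLiveMatching F K P M) :
    (residual P M).card = ∑ T ∈ M, (T \ P.avoiderSet).card :=
  Finset.card_biUnion fun _ hT _ hT' hne =>
    Finset.disjoint_of_subset_left Finset.sdiff_subset
      (Finset.disjoint_of_subset_right Finset.sdiff_subset (h.disj hT hT' hne))

theorem IsLiveMatching.card_residual_add (h : IsLiveMatching F K P M) :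
    (residual P M).card + ∑ T ∈ M, (K - (T \ P.avoiderSet).card) = K * M.card := by
  rw [h.card_residual, ← Finset.sum_add_distrib,
    Finset.sum_congr rfl fun T hT => Nat.add_sub_of_le (h.card_le T hT)]
  simp [mul_comm]

theorem IsLiveMatching.card_filter_lt_le (h : IsLiveMatching F K P M) {D : ℕ}
    (hD : (residual P M).card + D = K * M.card) :
    (M.filter fun T => (T \ P.avoiderSet).card < K).card ≤ D := by
  have hsum := h.card_residual_add
  have : D = ∑ T ∈ M, (K - (T \ P.avoiderSet).card) := by omega
  rw [this, Finset.card_filter]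
  refine Finset.sum_le_sum fun T _ => ?_
  split_ifs <;> omega

/-- Full edges contribute nothing to `D`, and every other edge at most `K`. -/
theorem IsLiveMatching.le_mul_card_filter_lt (h : IsLiveMatching F K P M) {D : ℕ}
    (hD : (residual P M).card + D = K * M.card) :
    D ≤ K * (M.filter fun T => (T \ P.avoiderSet).card < K).card := by
  have hsum := h.card_residual_add
  have : D = ∑ T ∈ M, (K - (T \ P.avoiderSet).card) := by omega
  rw [this, Finset.card_filter, Finset.mul_sum]
  refine Finset.sum_le_sum fun T _ => ?_
  split_ifs
  · simp
  · simp only [mul_zero]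
    omega

theorem IsLiveMatching.avoider_move (h : IsLiveMatching F K P M)
    (hturn : P.turn = Player.avoider) (S : Finset X) :
    IsLiveMatching F K (P.move S) M ∧ residual (P.move S) M = residual P M \ S := by
  have hA : (P.move S).avoiderSet = P.avoiderSet ∪ S := by simp [Position.move, hturn]
  have hE : (P.move S).enforcerSet = P.enforcerSet := by simp [Position.move, hturn]
  refine ⟨⟨h.subset, h.disj, fun T hT => hE ▸ h.untouched T hT, fun T hT => ?_⟩, ?_⟩
  · rw [hA]
    exact (Finset.card_le_card (Finset.sdiff_subset_sdiff subset_rfl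
      Finset.subset_union_left)).trans (h.card_le T hT)
  · ext x
    simp only [residual, hA, Finset.mem_biUnion, Finset.mem_sdiff, Finset.mem_union]
    grind

end

/-! ### Winning positions and strategies. -/

section

variable {X : Type*} [Fintype X] [DecidableEq X] {p q : ℕ} {F : Set (Finset X)}

/-- Enforcer can force Avoider to fill a target set from the given position. -/
inductive Wins (p q : ℕ) (F : Set (Finset X)) : Position X → Prop
  | done (P : Position X) (T : Finset X) (hT : T ∈ F) (h : T ⊆ P.avoiderSet) : Wins p q F P
  | avoider (P : Position X) (hturn : P.turn = Player.avoider)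
      (h : ∀ S, IsLegalMove p q P S → Wins p q F (P.move S)) : Wins p q F P
  | enforcer (P : Position X) (hturn : P.turn = Player.enforcer) (S : Finset X)
      (hS : IsLegalMove p q P S) (h : Wins p q F (P.move S)) : Wins p q F P

theorem Position.unclaimed_move (P : Position X) (S : Finset X) :
    (P.move S).unclaimed = P.unclaimed \ S := by
  unfold Position.move Position.unclaimed
  split <;> ext x <;> simp <;> tauto

theorem exists_isLegalMove (p q : ℕ) (P : Position X) : ∃ S, IsLegalMove p q P S :=
  Finset.exists_subset_card_eq (min_le_right _ _)

theorem Wins.exists_subset_of_unclaimed_eq_empty {P : Position X} (h : Wins p q F P)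
    (hP : P.unclaimed = ∅) : ∃ T ∈ F, T ⊆ P.avoiderSet := by
  induction h with
  | done P T hT h => exact ⟨T, hT, h⟩
  | avoider P hturn h ih =>
    have := ih ∅ ⟨by simp, by simp [hP]⟩ (by simp [Position.unclaimed_move, hP])
    rwa [Position.avoiderSet_move_empty] at this
  | enforcer P hturn S hS h ih =>
    have hS0 : S = ∅ := Finset.subset_empty.1 (hP ▸ hS.1)
    subst hS0
    have := ih (by simp [Position.unclaimed_move, hP])
    rwa [Position.avoiderSet_move_empty] at this

open Classical in
/-- A strategy that stays in winning positions whenever that is possible. -/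
noncomputable def winningStrategy (p q : ℕ) (F : Set (Finset X)) (P : Position X) : Finset X :=
  if h : ∃ S, IsLegalMove p q P S ∧ Wins p q F (P.move S) then h.choose
  else (exists_isLegalMove p q P).choose

theorem winningStrategy_isLegalMove (P : Position X) :
    IsLegalMove p q P (winningStrategy p q F P) := by
  unfold winningStrategy
  split_ifs with h
  · exact h.choose_spec.1
  · exact (exists_isLegalMove p q P).choose_spec

theorem Wins.move {P : Position X} (h : Wins p q F P) {S : Finset X} (hS : IsLegalMove p q P S)
    (hσ : P.turn = Player.enforcer → S = winningStrategy p q F P) : Wins p q F (P.move S) := by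
  cases h with
  | done _ T hT h => exact .done _ T hT (h.trans (P.avoiderSet_subset_move S))
  | avoider _ hturn h => exact h S hS
  | enforcer _ hturn S' hS' h =>
    have hex : ∃ S, IsLegalMove p q P S ∧ Wins p q F (P.move S) := ⟨S', hS', h⟩
    rw [hσ hturn, winningStrategy, dif_pos hex]
    exact hex.choose_spec.2

theorem IsPlay.exists_unclaimed_eq_empty (hp : 0 < p) (hq : 0 < q) {first : Player}
    {σ : Position X → Finset X} {P : ℕ → Position X} (hP : IsPlay p q first σ P) :
    ∃ m, (P m).unclaimed = ∅ := by
  have key : ∀ n i, (P i).unclaimed.card ≤ n → ∃ m, (P m).unclaimed = ∅ := by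
    intro n
    induction n with
    | zero => exact fun i hi => ⟨i, Finset.card_eq_zero.1 (by omega)⟩
    | succ n ih =>
      intro i hi
      obtain ⟨S, hS, hmove, -⟩ := hP.2 i
      by_cases h0 : (P i).unclaimed = ∅
      · exact ⟨i, h0⟩
      · have hpos := Finset.card_pos.2 (Finset.nonempty_iff_ne_empty.2 h0)
        have hb : 0 < bias p q (P i).turn := by cases (P i).turn <;> assumption
        refine ih (i + 1) ?_
        have h1 := hS.2
        rw [hmove, Position.unclaimed_move, Finset.card_sdiff_of_subset hS.1]
        omega
  exact key _ 0 le_rfl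

theorem Wins.enforcerHasWinningStrategy (hp : 0 < p) (hq : 0 < q) {first : Player}
    (h : Wins p q F (start X first)) : EnforcerHasWinningStrategy p q F first := by
  refine ⟨winningStrategy p q F, fun P _ => winningStrategy_isLegalMove P, fun P hP => ?_⟩
  obtain ⟨m, hm⟩ := hP.exists_unclaimed_eq_empty hp hq
  have hw : ∀ i, Wins p q F (P i) := by
    intro i
    induction i with
    | zero => rw [hP.1]; exact h
    | succ i ih =>
      obtain ⟨S, hS, hmove, hσ⟩ := hP.2 i
      rw [hmove]
      exact ih.move hS hσ
  exact ⟨m, hm, (hw m).exists_subset_of_unclaimed_eq_empty hm⟩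

/-! ### Enforcer's moves outside a live matching. -/

variable {K : ℕ} {P : Position X} {M : Finset (Finset X)}

theorem IsLiveMatching.residual_subset (h : IsLiveMatching F K P M) :
    residual P M ⊆ P.unclaimed := by
  intro x hx
  simp only [residual, Finset.mem_biUnion, Finset.mem_sdiff] at hx
  obtain ⟨T, hT, hxT, hxA⟩ := hx
  have := Finset.disjoint_left.1 (h.untouched T hT) hxT
  simp [Position.unclaimed, hxA, this]

theorem IsLiveMatching.enforcer_move (h : IsLiveMatching F K P M)
    (hturn : P.turn = Player.enforcer) {S : Finset X} (hS : S ⊆ P.unclaimed \ residual P M) :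
    IsLiveMatching F K (P.move S) M ∧ residual (P.move S) M = residual P M := by
  have hA : (P.move S).avoiderSet = P.avoiderSet := by simp [Position.move, hturn]
  have hE : (P.move S).enforcerSet = P.enforcerSet ∪ S := by simp [Position.move, hturn]
  refine ⟨⟨h.subset, h.disj, fun T hT => ?_, fun T hT => hA ▸ h.card_le T hT⟩, ?_⟩
  · rw [hE, Finset.disjoint_union_right]
    refine ⟨h.untouched T hT, Finset.disjoint_right.2 fun x hx hxT => ?_⟩
    have hx' := hS hx
    simp only [residual, Position.unclaimed, Finset.mem_sdiff, Finset.mem_compl,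
      Finset.mem_union, Finset.mem_biUnion] at hx'
    exact hx'.2 ⟨T, hT, hxT, fun hxA => hx'.1 (Or.inl hxA)⟩
  · simp only [residual, hA]

/-- Enforcer can claim free elements only, after giving up as few untouched edges as possible. -/
theorem IsLiveMatching.exists_enforcer_move (h : IsLiveMatching F K P M) (hK : 0 < K)
    (hturn : P.turn = Player.enforcer) {D f : ℕ}
    (hD : (residual P M).card + D = K * M.card)
    (hf : f + (residual P M).card = P.unclaimed.card) (hm : D + q ≤ M.card) :
    ∃ S M' c f', IsLegalMove p q P S ∧ IsLiveMatching F K (P.move S) M' ∧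
      M'.card + c = M.card ∧ c ≤ q ∧
      (residual (P.move S) M').card + D = K * M'.card ∧
      f' + (residual (P.move S) M').card = (P.move S).unclaimed.card ∧
      f' + q = f + K * c ∧ (q ≤ f → c = 0) ∧ (f < q → f' < K) := by
  -- This is the ceiling of `(q - f) / K` with truncated subtraction: the least number of full edges
  -- whose elements make up the shortage.
  set c := (q - f + K - 1) / K with hc
  have hc1 : K * c ≤ q - f + K - 1 := Nat.mul_div_le _ _
  have hc2 : q - f + K - 1 < K * c + K := by
    have := Nat.lt_mul_div_succ (q - f + K - 1) hK
    rwa [mul_add, mul_one] at this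
  have hc0 : q ≤ f → c = 0 := fun hqf => Nat.div_eq_of_lt (by omega)
  have hcq : c ≤ q := by
    by_contra hlt
    have h1 : K * (q + 1) ≤ K * c := Nat.mul_le_mul_left _ (by omega)
    have h2 : q ≤ K * q := Nat.le_mul_of_pos_left _ hK
    rw [mul_add, mul_one] at h1
    omega
  -- At most `D` edges are not full, so at least `q ≥ c` full ones exist.
  have hfull : c ≤ (M.filter fun T => ¬ (T \ P.avoiderSet).card < K).card := by
    have h1 := h.card_filter_lt_le hD
    have h2 := M.card_filter_add_card_filter_not (fun T => (T \ P.avoiderSet).card < K)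
    omega
  obtain ⟨C, hC, hCc⟩ := Finset.exists_subset_card_eq hfull
  have hCM : C ⊆ M := hC.trans (Finset.filter_subset _ _)
  have hM' := h.mono (Finset.sdiff_subset (s := M) (t := C))
  have hcard : (M \ C).card + c = M.card := by
    have := Finset.card_sdiff_add_card_eq_card hCM
    omega
  have hCsum : ∑ T ∈ C, (T \ P.avoiderSet).card = K * c := by
    rw [Finset.sum_congr rfl (g := fun _ => K), Finset.sum_const, hCc, smul_eq_mul, mul_comm]
    intro T hT
    have h1 := (Finset.mem_filter.1 (hC hT)).2
    have h2 := h.card_le T (hCM hT)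
    omega
  have hres : (residual P (M \ C)).card + K * c = (residual P M).card := by
    rw [h.card_residual, hM'.card_residual, ← hCsum]
    exact Finset.sum_sdiff hCM
  have hfree : (P.unclaimed \ residual P (M \ C)).card = f + K * c := by
    rw [Finset.card_sdiff_of_subset hM'.residual_subset]
    omega
  obtain ⟨S, hS, hSc⟩ := Finset.exists_subset_card_eq
    (show q ≤ (P.unclaimed \ residual P (M \ C)).card by omega)
  have hSU : S ⊆ P.unclaimed := hS.trans Finset.sdiff_subset
  have hUle := Finset.card_le_card hSU
  obtain ⟨hlive, hreseq⟩ := hM'.enforcer_move hturn hS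
  refine ⟨S, M \ C, c, f + K * c - q, ⟨hSU, ?_⟩, hlive, hcard, hcq, ?_, ?_, by omega, hc0,
    fun _ => by omega⟩
  · rw [hturn, hSc]
    simp only [bias]
    omega
  · have : K * M.card = K * (M \ C).card + K * c := by rw [← hcard, mul_add]
    rw [hreseq]
    omega
  · rw [hreseq, Position.unclaimed_move, Finset.card_sdiff_of_subset hSU]
    omega

end

/-! ### Residues modulo `K` and the supply of edges. -/

theorem exists_sub_mul_emod_lt {n K p : ℕ} (hK : 0 < K) (hg : Nat.gcd n K ≤ p) (f : ℤ) :
    ∃ s : ℕ, s < K ∧ (f - s * n) % K < p := by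
  have hg0 : (0 : ℤ) < Nat.gcd n K := by exact_mod_cast Nat.gcd_pos_of_pos_right n hK
  have hbez := Nat.gcd_eq_gcd_ab n K
  have hgK : (Nat.gcd n K : ℤ) ≤ K := by exact_mod_cast Nat.gcd_le_right n hK
  set g : ℤ := (Nat.gcd n K : ℤ) with hgdef
  set x := Nat.gcdA n K
  set y := Nat.gcdB n K
  have hr0 := Int.emod_nonneg f hg0.ne'
  have hr1 := Int.emod_lt_of_pos f hg0
  have hdm := Int.mul_ediv_add_emod f g
  have hK' : (0 : ℤ) < K := by exact_mod_cast hK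
  have hs0 := Int.emod_nonneg (x * (f / g)) hK'.ne'
  have hs1 := Int.emod_lt_of_pos (x * (f / g)) hK'
  have hsm := Int.mul_ediv_add_emod (x * (f / g)) K
  -- By Bézout `x * n ≡ g` modulo `K`, so subtracting this multiple of `n` leaves `f % g < g ≤ p`.
  refine ⟨((x * (f / g)) % K).toNat, by omega, ?_⟩
  rw [Int.toNat_of_nonneg hs0]
  have : f - (x * (f / g)) % K * n = f % g + K * (y * (f / g) + (x * (f / g)) / K * n) := by
    linear_combination -hdm + (f / g) * hbez - (n : ℤ) * hsm
  rw [this, Int.add_mul_emod_self_left, Int.emod_eq_of_lt hr0 (by omega)]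
  have : g ≤ p := by rw [hgdef]; exact_mod_cast hg
  omega

/-- How many edges must be left when Avoider has made `D` steps of progress and the number of
free elements is to drop below `p` after `s` rounds. -/
def edgeBound (p q K L D s : ℕ) : ℕ := L + p + q + ((L - D) * (K + 2) + s) * q

/-- Progress in `D` frees `K + 2` rounds of budget, enough to pay for the current round and to reset
the countdown to any `s ≤ K`. -/
theorem edgeBound_of_lt {p q K L D D' s s' : ℕ} (hD : D < D') (hL : D < L) (hs : s ≤ K) :
    edgeBound p q K L D' s + q ≤ edgeBound p q K L D s' := by
  unfold edgeBound
  have h1 : (L - D') * (K + 2) + s + 1 ≤ (L - D) * (K + 2) + s' := by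
    have h2 : (L - D' + 1) * (K + 2) ≤ (L - D) * (K + 2) := Nat.mul_le_mul_right _ (by omega)
    rw [add_mul] at h2
    omega
  have := Nat.mul_le_mul_right q h1
  rw [add_mul _ 1] at this
  omega

theorem edgeBound_of_lt_right {p q K L D s s' : ℕ} (hs : s < s') :
    edgeBound p q K L D s + q ≤ edgeBound p q K L D s' := by
  unfold edgeBound
  have := Nat.mul_le_mul_right q (show (L - D) * (K + 2) + s + 1 ≤ (L - D) * (K + 2) + s' by omega)
  rw [add_mul _ 1] at this
  omega

/-! ### Forcing progress at a fixed edge size. -/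

section

variable {X : Type*} [Fintype X] [DecidableEq X] {p q : ℕ} {F : Set (Finset X)} {K : ℕ}

/-- The countdown `s` runs only once `f < K`; before that it rests at `K`, since such rounds cost no
edges. Termination comes from the shrinking set of unclaimed elements. -/
theorem wins_of_edgeBound (hq : 0 < q) (hK : 0 < K) (hg : Nat.gcd (p + q) K ≤ p) {L : ℕ}
    (hwin : ∀ (P : Position X) (M : Finset (Finset X)) (D : ℕ), IsLiveMatching F K P M →
      (residual P M).card + D = K * M.card → L ≤ D → Wins p q F P) :
    ∀ (n : ℕ) (P : Position X) (M : Finset (Finset X)) (D f s : ℕ), P.unclaimed.card ≤ n →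
      P.turn = Player.avoider → IsLiveMatching F K P M →
      (residual P M).card + D = K * M.card → f + (residual P M).card = P.unclaimed.card →
      s ≤ K → edgeBound p q K L D s ≤ M.card → (K ≤ f → s = K) →
      (f < K → ((f : ℤ) - s * (p + q : ℕ)) % K < p) → Wins p q F P := by
  intro n
  induction n using Nat.strong_induction_on with
  | _ n ih =>
  intro P M D f s hn hturn hM hD hf hsK hm hfs hmod
  by_cases hDL : L ≤ D
  · exact hwin P M D hM hD hDL
  push Not at hDL
  -- While `D < L`, this reserve ensures that neither player's move in this round is cut short and
  -- that enough full edges exist.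
  have hmL : L + p + q ≤ M.card := le_trans (by unfold edgeBound; omega) hm
  have hKm : M.card ≤ K * M.card := Nat.le_mul_of_pos_left _ hK
  refine .avoider P hturn fun S hS => ?_
  have hSc : S.card = p := by
    rw [hS.2, hturn]
    simp only [bias]
    omega
  obtain ⟨hM1, hres1⟩ := hM.avoider_move hturn S
  have hturn1 : (P.move S).turn = Player.enforcer := by simp [Position.move, hturn]
  have hU1 : (P.move S).unclaimed.card + p = P.unclaimed.card := by
    rw [Position.unclaimed_move, Finset.card_sdiff_of_subset hS.1]
    have := Finset.card_le_card hS.1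
    omega
  -- `j` counts the elements Avoider has just claimed inside the matching, that is, the growth of
  -- `D`.
  obtain ⟨j, hj⟩ : ∃ j, (residual (P.move S) M).card + j = (residual P M).card :=
    ⟨(residual P M ∩ S).card, by rw [hres1]; exact Finset.card_sdiff_add_card_inter _ _⟩
  have hR1 := Finset.card_le_card hM1.residual_subset
  set P1 := P.move S
  set D1 := D + j with hD1
  obtain ⟨f1, hf1⟩ : ∃ f1, f1 + (residual P1 M).card = P1.unclaimed.card :=
    ⟨_, Nat.sub_add_cancel hR1⟩
  have hff : f1 + p = f + j := by omega
  by_cases hDL1 : L ≤ D1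
  · exact hwin P1 M D1 hM1 (by omega) hDL1
  obtain ⟨S2, M2, c, f2, hS2, hM2, hc, hcq, hD2, hf2, hfc, hc0, hfK⟩ :=
    hM1.exists_enforcer_move (p := p) (q := q) hK hturn1 (D := D1) (by omega) hf1 (by omega)
  refine .enforcer P1 hturn1 S2 hS2 ?_
  have hturn2 : (P1.move S2).turn = Player.avoider := by simp [Position.move, hturn1]
  have hU2 : (P1.move S2).unclaimed.card < n := by
    have := Finset.card_le_card hS2.1
    have h2 := hS2.2
    rw [hturn1] at h2
    simp only [bias] at h2
    rw [Position.unclaimed_move, Finset.card_sdiff_of_subset hS2.1]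
    have : M.card ≤ (residual P1 M).card + D1 := by omega
    omega
  have step : ∀ s2, s2 ≤ K → edgeBound p q K L D1 s2 ≤ M2.card → (K ≤ f2 → s2 = K) →
      (f2 < K → ((f2 : ℤ) - s2 * (p + q : ℕ)) % K < p) → Wins p q F (P1.move S2) :=
    fun s2 => ih _ hU2 _ M2 D1 f2 s2 le_rfl hturn2 hM2 hD2 hf2
  obtain ⟨s0, hs0, hs0mod⟩ := exists_sub_mul_emod_lt hK hg (f2 : ℤ)
  rcases Nat.eq_zero_or_pos j with hj0 | hjpos
  · have hD1D : D1 = D := by omega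
    rw [hD1D] at step
    have hc' : (q ≤ f1 ∧ c = 0) ∨ (f1 < q ∧ f2 < K) := by
      rcases le_or_gt q f1 with h | h
      · exact .inl ⟨h, hc0 h⟩
      · exact .inr ⟨h, hfK h⟩
    rcases lt_or_ge f K with hfltK | hKf
    -- With `s = 0` and `f < K` the residue condition reads `f < p`, so Avoider could not have
    -- stayed on free elements.
    · have hspos : 0 < s := by
        by_contra hs
        have hs : s = 0 := by omega
        have := hmod hfltK
        rw [hs, Int.emod_eq_of_lt (by simp) (by simp; omega)] at this
        push_cast at this
        omega
      have hb := edgeBound_of_lt_right (p := p) (q := q) (K := K) (L := L) (D := D)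
        (show s - 1 < s by omega)
      have hf2K : f2 < K := by
        rcases hc' with ⟨_, h⟩ | h
        · subst h; omega
        · exact h.2
      refine step (s - 1) (by omega) (by omega) (by omega) fun _ => ?_
      -- The countdown absorbs the `p + q` elements claimed, and the edges given up contribute a
      -- multiple of `K`.
      have hcast : (f2 : ℤ) - ((s - 1 : ℕ) : ℤ) * (p + q : ℕ)
          = (f : ℤ) - s * (p + q : ℕ) + K * c := by
        have e1 : (f2 : ℤ) + q = f1 + K * c := by exact_mod_cast hfc
        have e2 : (f1 : ℤ) + p = f + j := by exact_mod_cast hff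
        have e3 : (j : ℤ) = 0 := by exact_mod_cast hj0
        push_cast [Nat.cast_sub hspos]
        linear_combination e1 + e2 + e3
      rw [hcast, Int.add_mul_emod_self_left]
      exact hmod hfltK
    · have hs := hfs hKf
      subst hs
      have hb := edgeBound_of_lt_right (p := p) (q := q) (K := s) (L := L) (D := D) hs0
      -- Here `s` is `K`. Either the free elements have just dropped below `K` and the countdown
      -- starts at `s0 < K`, or no edge was given up and the bound persists.
      rcases lt_or_ge f2 s with h | h
      · exact step s0 hs0.le (by omega) (by omega) fun _ => hs0mod
      · rcases hc' with ⟨_, h0⟩ | h'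
        · exact step s le_rfl (by omega) (fun _ => rfl) (by omega)
        · omega
  · rcases lt_or_ge f2 K with h | h
    · have hb := edgeBound_of_lt (p := p) (q := q) (K := K) (L := L) (s' := s)
        (show D < D1 by omega) hDL hs0.le
      exact step s0 hs0.le (by omega) (by omega) fun _ => hs0mod
    · have hb := edgeBound_of_lt (p := p) (q := q) (K := K) (L := L) (s' := s)
        (show D < D1 by omega) hDL le_rfl
      exact step K le_rfl (by omega) (fun _ => rfl) (by omega)

theorem edgeBound_zero_le {L D s : ℕ} (hs : s ≤ K) :
    edgeBound p q K L D s ≤ edgeBound p q K L 0 K := by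
  unfold edgeBound
  gcongr
  omega

theorem wins_of_le_card (hq : 0 < q) (hK : 0 < K) (hg : Nat.gcd (p + q) K ≤ p) {L : ℕ}
    (hwin : ∀ (P : Position X) (M : Finset (Finset X)) (D : ℕ), IsLiveMatching F K P M →
      (residual P M).card + D = K * M.card → L ≤ D → Wins p q F P)
    (P : Position X) (M : Finset (Finset X)) (hM : IsLiveMatching F K P M)
    (hN : edgeBound p q K L 0 K + q ≤ M.card) : Wins p q F P := by
  have havoider : ∀ (P : Position X) (M : Finset (Finset X)), P.turn = Player.avoider →
      IsLiveMatching F K P M → edgeBound p q K L 0 K ≤ M.card → Wins p q F P := by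
    intro P M hturn hM hN
    have hR := Finset.card_le_card hM.residual_subset
    obtain ⟨f, hf⟩ : ∃ f, f + (residual P M).card = P.unclaimed.card :=
      ⟨_, Nat.sub_add_cancel hR⟩
    obtain ⟨s0, hs0, hs0mod⟩ := exists_sub_mul_emod_lt hK hg (f : ℤ)
    rcases lt_or_ge f K with h | h
    · exact wins_of_edgeBound hq hK hg hwin _ P M _ f s0 le_rfl hturn hM hM.card_residual_add hf
        hs0.le ((edgeBound_zero_le hs0.le).trans hN) (by omega) fun _ => hs0mod
    · exact wins_of_edgeBound hq hK hg hwin _ P M _ f K le_rfl hturn hM hM.card_residual_add hf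
        le_rfl ((edgeBound_zero_le le_rfl).trans hN) (fun _ => rfl) (by omega)
  cases hturn : P.turn with
  | avoider => exact havoider P M hturn hM (by omega)
  | enforcer =>
    have hD := hM.card_residual_add
    by_cases hDL : L ≤ ∑ T ∈ M, (K - (T \ P.avoiderSet).card)
    · exact hwin P M _ hM hD hDL
    have hR := Finset.card_le_card hM.residual_subset
    have hL : L + q ≤ edgeBound p q K L 0 K := by unfold edgeBound; omega
    obtain ⟨S, M', c, f', hS, hM', hc, hcq, -⟩ :=
      hM.exists_enforcer_move (p := p) (q := q) hK hturn hD (Nat.sub_add_cancel hR) (by omega)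
    exact .enforcer P hturn S hS
      (havoider _ M' (by simp [Position.move, hturn]) hM' (by omega))

end

-- Induction on the edge size.

universe u

theorem exists_card_forall_wins (p q : ℕ) (hq : 0 < q) (k : ℕ)
    (hgcd : ∀ l : ℕ, 1 ≤ l → l ≤ k → Nat.gcd (p + q) l ≤ p) :
    ∃ N : ℕ, ∀ (X : Type u) [Fintype X] [DecidableEq X] (F : Set (Finset X)) (P : Position X)
      (M : Finset (Finset X)), IsLiveMatching F k P M → N ≤ M.card → Wins p q F P := by
  induction k with
  | zero =>
    refine ⟨1, fun X _ _ F P M hM hN => ?_⟩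
    obtain ⟨T, hT⟩ := Finset.card_pos.1 hN
    refine .done P T (hM.subset hT) (Finset.sdiff_eq_empty_iff_subset.1 ?_)
    exact Finset.card_eq_zero.1 (Nat.le_zero.1 (hM.card_le T hT))
  | succ k ih =>
    obtain ⟨N, hN⟩ := ih fun l h1 h2 => hgcd l h1 (by omega)
    refine ⟨_, fun X _ _ F P M hM hcard => wins_of_le_card hq k.succ_pos
      (hgcd (k + 1) (by omega) le_rfl) (L := (k + 1) * N) ?_ P M hM hcard⟩
    intro P M D hM hD hL
    have hlow := hM.mono (Finset.filter_subset (fun T => (T \ P.avoiderSet).card < k + 1) M)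
    refine hN X F P _ ⟨hlow.subset, hlow.disj, hlow.untouched, fun T hT => ?_⟩ ?_
    · have := (Finset.mem_filter.1 hT).2
      omega
    · exact Nat.le_of_mul_le_mul_left (hL.trans (hM.le_mul_card_filter_lt hD)) k.succ_pos

end AvoiderEnforcer

theorem corollary1p5 (p q k : ℕ) (hp : 0 < p) (hq : 0 < q) (hk : 0 < k)
    (hgcd : ∀ l : ℕ, 1 ≤ l → l ≤ k → Nat.gcd (p + q) l ≤ p) :
    ∃ N : ℕ, ∀ (X : Type*) [Fintype X] [DecidableEq X] (F : Set (Finset X)),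
      (∃ M : Finset (Finset X), (M : Set (Finset X)) ⊆ F ∧
        (M : Set (Finset X)).PairwiseDisjoint id ∧
        M.card = N ∧
        ∀ T ∈ M, T.card ≤ k) →
      ∀ first : AvoiderEnforcer.Player,
        AvoiderEnforcer.EnforcerHasWinningStrategy p q F first := by
  obtain ⟨N, hN⟩ := AvoiderEnforcer.exists_card_forall_wins p q hq k hgcd
  refine ⟨N, fun X _ _ F ⟨M, hMF, hdisj, hcard, hle⟩ first => ?_⟩
  refine (hN X F _ M ⟨hMF, hdisj, fun T _ => ?_, fun T hT => ?_⟩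
    hcard.ge).enforcerHasWinningStrategy hp hq
  · simp [AvoiderEnforcer.start]
  · simpa [AvoiderEnforcer.start] using hle T hT
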